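/- **Theorem (accuracy gap of Model Picker on stochastic streams).** Let $f_1,\dots,f_k:\mathcal X\to\mathcal C$ ($k\ge 2$) be measurable classifiers with a finite label set $\mathcal C$, and let $(x_t,c_t)_{t\ge1}$ be an i.i.d. stream in $\mathcal X\times\mathcal C$. Put $\ell_{t,i}=\mathbf 1\{f_i(x_t)\ne c_t\}$. Assume that there is a unique best model $i^*$, that is, $\Delta_j:=\mathbb E[\ell_{\cdot,j}-\ell_{\cdot,i^*}]>0$ for all $j\ne i^*$, and let $$\theta_j=\Pr\{\ell_{\cdot,j}\ne\ell_{\cdot,i^*}\},\qquad \lambda=\min_{j\ne i^*}\Delta_j^2/\theta_j .$$ Model Picker starts with $\widehat L_0=0$ and does the following in round $t=1,2,\dots$. Let $\eta_t=\sqrt{\log k/(2t)}$ and $w_{t,i}\propto\exp(-\eta_t\widehat L_{t-1,i})$. It recommends a model $\pi_t\in\operatorname{argmax}_i w_{t,i}$ (ties broken arbitrarily) and draws $I_t\sim w_t$. With $\ell^{(c)}_{t,i}=\mathbf 1\{f_i(x_t)\neq c\}$ and $v_t=\max_{c\in\mathcal C}\langle w_t,\ell_t^{(c)}\rangle(1-\langle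 w_t,\ell_t^{(c)}\rangle)$, it sets $q_t=\min\{1,\max\{v_t,\eta_t\}\}$ if $v_t\ne0$ and $q_t=0$ otherwise, and draws $Q_t\sim\mathrm{Ber}(q_t)$. If $Q_t=1$, it queries $c_t$ and sets $\widehat L_{t,i}=\widehat L_{t-1,i}+\ell_{t,i}/q_t$ for all $i$; otherwise $\widehat L_t=\widehat L_{t-1}$. Then for every $\varepsilon>0$ and every $T\ge1$ the expected accuracy gap satisfies $\mathbb E[\Delta_{\pi_T}]\le\varepsilon$ as soon as $$T\;\ge\;31\cdot\frac{\log^2\!\big(k\max_i\Delta_i/\varepsilon\big)}{\lambda^2\log k}.$$ In particular, if $|\log(k\max_i\Delta_i)|+\log\frac1\varepsilon\le|\log(k\max_i\Delta_i)|\cdot\log\frac1\varepsilon$ (for instance, if $|\log(k\max_i\Delta_i)|\ge2$ and $\log\frac1\varepsilon\ge2$), then it is enough that $$T\;\ge\;31\cdot\frac{\log^2\!\big(k\max_i\Delta_i\big)}{\lambda^2\log k}\,\log^2\!\big(\tfrac1\varepsilon\big).$$ -/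

import Mathlib

open MeasureTheory ProbabilityTheory

namespace ModelPicker

noncomputable section

/-! ### The algorithm

Rounds are numbered `t = 1, 2, 3, …`; index `0` of a sequence is never used. There are `k` models
`f i : X → C`; the prediction vector at the instance `x` is `fun i => f i x`. -/

/-- The zero-one loss of model `i` for the prediction vector `p` and the label `c`. -/
def loss {C : Type*} [DecidableEq C] {k : ℕ} (p : Fin k → C) (c : C) (i : Fin k) : ℝ :=
  if p i ≠ c then 1 else 0

/-- The learning rate `η_t = √(log k / (2 t))`. -/
def learningRate (k t : ℕ) : ℝ :=
  Real.sqrt (Real.log k / (2 * t))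

/-- The weights `w_{t,i} ∝ exp (-η_t L_i)` of round `t`, where `L` is the vector of estimated
cumulative losses before round `t`. -/
def weight {k : ℕ} (t : ℕ) (L : Fin k → ℝ) (i : Fin k) : ℝ :=
  Real.exp (-learningRate k t * L i) / ∑ j, Real.exp (-learningRate k t * L j)

/-- `v(p, w) = max_c ⟨w, ℓ^(c)⟩ (1 - ⟨w, ℓ^(c)⟩)`, the largest variance over the possible labels of
the loss of a model drawn from `w`. -/
def maxVariance {C : Type*} [DecidableEq C] {k : ℕ} (p : Fin k → C) (w : Fin k → ℝ) : ℝ :=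
  ⨆ c : C, (∑ i, w i * loss p c i) * (1 - ∑ i, w i * loss p c i)

/-- The query probability `q_t`: it is `0` if `v(p_t, w_t) = 0`, and otherwise the maximum of
`v(p_t, w_t)` and `η_t`, cut off at `1` (in the first rounds `η_t` can exceed `1`). -/
def queryProb {C : Type*} [DecidableEq C] {k : ℕ} (t : ℕ) (L : Fin k → ℝ) (p : Fin k → C) : ℝ :=
  if maxVariance p (weight t L) ≠ 0 then
    min 1 (max (maxVariance p (weight t L)) (learningRate k t))
  else 0

/-- The estimated cumulative losses after round `t`, given the instances `x`, the labels `c`, and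
the outcomes `Q` of the query coins. -/
def estLoss {X C : Type*} [DecidableEq C] {k : ℕ} (f : Fin k → X → C)
    (x : ℕ → X) (c : ℕ → C) (Q : ℕ → Bool) : ℕ → Fin k → ℝ
  | 0 => fun _ => 0
  | t + 1 => fun i =>
      estLoss f x c Q t i +
        if Q (t + 1) = true then
          1 / queryProb (t + 1) (estLoss f x c Q t) (fun j => f j (x (t + 1))) *
            loss (fun j => f j (x (t + 1))) (c (t + 1)) i
        else 0

/-! ### Random executions -/

/-- The σ-algebra of everything that happened in rounds `1, …, t - 1`: instances, labels, drawn
models, and query coins. -/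
@[reducible] def history {Ω X C : Type*} [MeasurableSpace X] [MeasurableSpace C] {k : ℕ}
    (x : ℕ → Ω → X) (c : ℕ → Ω → C) (I : ℕ → Ω → Fin k) (Q : ℕ → Ω → Bool) (t : ℕ) :
    MeasurableSpace Ω :=
  ⨆ s ∈ Finset.Ico 1 t,
    MeasurableSpace.comap (fun ω => (x s ω, c s ω, I s ω, Q s ω)) inferInstance

/-- `x, c, I, Q` are the instances, the labels, the drawn models, and the query coins of an execution
of the algorithm for `T` rounds on an i.i.d. stream with distribution `D`:
in each round `t` the pair `(x_t, c_t)` has law `D` and is independent of the earlier rounds; then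
`I_t` is drawn from `w_t`, and then the coin `Q_t` is thrown with success probability `q_t`. -/
structure IsRun {Ω X C : Type*} [MeasurableSpace Ω] [MeasurableSpace X] [MeasurableSpace C]
    [DecidableEq C] {k : ℕ} (D : Measure (X × C)) (f : Fin k → X → C) (μ : Measure Ω) (T : ℕ)
    (x : ℕ → Ω → X) (c : ℕ → Ω → C) (I : ℕ → Ω → Fin k) (Q : ℕ → Ω → Bool) : Prop where
  measurable_x : ∀ t ∈ Finset.Icc 1 T, Measurable (x t)
  measurable_c : ∀ t ∈ Finset.Icc 1 T, Measurable (c t)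
  measurable_I : ∀ t ∈ Finset.Icc 1 T, Measurable (I t)
  measurable_Q : ∀ t ∈ Finset.Icc 1 T, Measurable (Q t)
  law_stream : ∀ t ∈ Finset.Icc 1 T, Measure.map (fun ω => (x t ω, c t ω)) μ = D
  indep_stream : ∀ t ∈ Finset.Icc 1 T,
    Indep (MeasurableSpace.comap (fun ω => (x t ω, c t ω)) inferInstance) (history x c I Q t) μ
  condProb_I : ∀ t ∈ Finset.Icc 1 T, ∀ i : Fin k,
    μ[fun ω => if I t ω = i then (1 : ℝ) else 0 |
        history x c I Q t ⊔ MeasurableSpace.comap (fun ω => (x t ω, c t ω)) inferInstance]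
      =ᵐ[μ] fun ω =>
        weight t (estLoss f (fun s => x s ω) (fun s => c s ω) (fun s => Q s ω) (t - 1)) i
  condProb_Q : ∀ t ∈ Finset.Icc 1 T,
    μ[fun ω => if Q t ω = true then (1 : ℝ) else 0 |
        history x c I Q t ⊔
          MeasurableSpace.comap (fun ω => (x t ω, c t ω, I t ω)) inferInstance]
      =ᵐ[μ] fun ω =>
        queryProb t (estLoss f (fun s => x s ω) (fun s => c s ω) (fun s => Q s ω) (t - 1))
          (fun j => f j (x t ω))

/-- `r` is a recommendation `π_t` of round `t`: a random model that almost surely has the largest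
weight `w_{t,i}`, with ties broken in an arbitrary (measurable) way. -/
def IsRecommendation {Ω X C : Type*} [MeasurableSpace Ω] [DecidableEq C] {k : ℕ}
    (f : Fin k → X → C) (μ : Measure Ω) (x : ℕ → Ω → X) (c : ℕ → Ω → C) (Q : ℕ → Ω → Bool)
    (t : ℕ) (r : Ω → Fin k) : Prop :=
  Measurable r ∧ ∀ᵐ ω ∂μ, ∀ i : Fin k,
    weight t (estLoss f (fun s => x s ω) (fun s => c s ω) (fun s => Q s ω) (t - 1)) i ≤
      weight t (estLoss f (fun s => x s ω) (fun s => c s ω) (fun s => Q s ω) (t - 1)) (r ω)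

/-! ### Parameters of the stream -/

/-- The accuracy gap `Δ_j = 𝔼[ℓ_j - ℓ_{i⋆}]` between the models `i⋆` and `j`. -/
def accGap {X C : Type*} [MeasurableSpace X] [MeasurableSpace C] [DecidableEq C] {k : ℕ}
    (D : Measure (X × C)) (f : Fin k → X → C) (iStar j : Fin k) : ℝ :=
  ∫ z, (loss (fun i => f i z.1) z.2 j - loss (fun i => f i z.1) z.2 iStar) ∂D

/-- `θ_j = ℙ(ℓ_j ≠ ℓ_{i⋆})`. -/
def disagreement {X C : Type*} [MeasurableSpace X] [MeasurableSpace C] [DecidableEq C] {k : ℕ}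
    (D : Measure (X × C)) (f : Fin k → X → C) (iStar j : Fin k) : ℝ :=
  D.real {z | loss (fun i => f i z.1) z.2 j ≠ loss (fun i => f i z.1) z.2 iStar}

/-- `λ = min_{j ≠ i⋆} Δ_j² / θ_j`. -/
def hardness {X C : Type*} [MeasurableSpace X] [MeasurableSpace C] [DecidableEq C] {k : ℕ}
    (D : Measure (X × C)) (f : Fin k → X → C) (iStar : Fin k) : ℝ :=
  ⨅ j : {j : Fin k // j ≠ iStar}, accGap D f iStar j ^ 2 / disagreement D f iStar j

/-- `max_i Δ_i`. -/
def maxGap {X C : Type*} [MeasurableSpace X] [MeasurableSpace C] [DecidableEq C] {k : ℕ}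
    (D : Measure (X × C)) (f : Fin k → X → C) (iStar : Fin k) : ℝ :=
  ⨆ i : Fin k, accGap D f iStar i

end

end ModelPicker

namespace ModelPicker

/-! ### The loss, the weights, and the query probability -/

section Deterministic

variable {C : Type*} [DecidableEq C] {k : ℕ}

/-! This is a Chernoff bound for the difference of estimated losses between a suboptimal model `j`
and the best model.

Whenever the models do not all agree, the query probability is at least `min 1 η_t`. When they all
agree, the round has no effect on loss differences, so not querying costs nothing. Learning rates
decrease, so if `η_T ≤ 1`, every importance weight that matters up to round `T` is at most `B =
1/η_T`. Conditionally on the past, the estimated difference added in a round therefore has mean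
`Δ_j` and second moment at most `B θ_j`. Consequently `𝔼 exp (-s (L_j - L_{i⋆}))` is multiplied per
round by at most `1 - s Δ_j + (3/4) s² B θ_j`, provided `s B ≤ 2/3` (`query_exp_bound`,
`integral_mul_exp_query_le`, `integral_exp_succ_le`).

A model recommended in place of `i⋆` has no larger estimated loss, so this exponential is at least
`1` there. After `T - 1` rounds and with the best `s`, the probability of recommending `j` is at
most `exp (-(T-1) η_T Δ_j² / (3 θ_j))` (`measureReal_recommendation_le`). The condition on `T` makes
this at most `ε / (k max Δ)` (`le_exponent_of_le`), and summing over the `k` models gives `ε`. If `ε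
≥ max Δ`, there is nothing to prove. -/

lemma loss_nonneg (p : Fin k → C) (c : C) (i : Fin k) : 0 ≤ loss p c i := by
  unfold loss; split_ifs <;> norm_num

lemma loss_le_one (p : Fin k → C) (c : C) (i : Fin k) : loss p c i ≤ 1 := by
  unfold loss; split_ifs <;> norm_num

lemma abs_loss_sub_loss_le_one (p : Fin k → C) (c : C) (i j : Fin k) :
    |loss p c j - loss p c i| ≤ 1 := by
  have h1 := loss_nonneg p c i
  have h2 := loss_nonneg p c j
  have h3 := loss_le_one p c i
  have h4 := loss_le_one p c j
  rw [abs_le]; constructor <;> linarith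

lemma log_natCast_pos (hk : 2 ≤ k) : 0 < Real.log k :=
  Real.log_pos (by exact_mod_cast hk)

lemma learningRate_pos (hk : 2 ≤ k) {t : ℕ} (ht : 1 ≤ t) : 0 < learningRate k t := by
  have h1 : (0 : ℝ) < t := by exact_mod_cast ht
  exact Real.sqrt_pos.2 (div_pos (log_natCast_pos hk) (by positivity))

lemma weight_pos [Nonempty (Fin k)] (t : ℕ) (L : Fin k → ℝ) (i : Fin k) : 0 < weight t L i :=
  div_pos (Real.exp_pos _) (Finset.sum_pos (fun _ _ => Real.exp_pos _) Finset.univ_nonempty)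

lemma sum_weight [Nonempty (Fin k)] (t : ℕ) (L : Fin k → ℝ) : ∑ i, weight t L i = 1 := by
  unfold weight
  rw [← Finset.sum_div]
  exact div_self (Finset.sum_pos (fun _ _ => Real.exp_pos _) Finset.univ_nonempty).ne'

/-- A model of larger weight has smaller estimated loss. -/
lemma le_of_weight_le (hk : 2 ≤ k) {t : ℕ} (ht : 1 ≤ t) {L : Fin k → ℝ} {i j : Fin k}
    (h : weight t L i ≤ weight t L j) : L j ≤ L i := by
  have : Nonempty (Fin k) := ⟨i⟩
  have hS : 0 < ∑ j, Real.exp (-learningRate k t * L j) :=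
    Finset.sum_pos (fun _ _ => Real.exp_pos _) Finset.univ_nonempty
  have h1 := Real.exp_le_exp.1 ((div_le_div_iff_of_pos_right hS).1 h)
  nlinarith [learningRate_pos hk ht]

/-- If the largest variance vanishes, then all models agree. -/
lemma eq_of_maxVariance_eq_zero [Finite C] {p : Fin k → C} {w : Fin k → ℝ} (hw : ∀ i, 0 < w i)
    (hsum : ∑ i, w i = 1) (h : maxVariance p w = 0) (i j : Fin k) : p j = p i := by
  -- The label tested is the prediction of `i` itself: model `i` then has loss `0` and positive
  -- weight, so `u < 1`. Vanishing variance forces `u ≤ 0`, while a model disagreeing with `i` would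
  -- contribute a positive term.
  set u := ∑ l, w l * loss p (p i) l with hu
  have h1 : u * (1 - u) ≤ 0 := by
    rw [← h]
    exact le_ciSup (f := fun c : C => (∑ l, w l * loss p c l) * (1 - ∑ l, w l * loss p c l))
      (Set.finite_range _).bddAbove (p i)
  have h2 : 0 < 1 - u := by
    rw [hu, ← hsum, ← Finset.sum_sub_distrib]
    refine Finset.sum_pos' (fun l _ => ?_) ⟨i, Finset.mem_univ _, ?_⟩
    · nlinarith [hw l, loss_le_one p (p i) l]
    · simpa [loss] using hw i
  have h3 : w j * loss p (p i) j ≤ u :=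
    Finset.single_le_sum (f := fun l => w l * loss p (p i) l)
      (fun l _ => mul_nonneg (hw l).le (loss_nonneg _ _ _)) (Finset.mem_univ j)
  by_contra hne
  have h4 : loss p (p i) j = 1 := by simp [loss, hne]
  rw [h4] at h3
  nlinarith [hw j]

/-- Either the query probability is bounded below, or it vanishes and all models have the same
loss. -/
lemma queryProb_cases [Finite C] [Nonempty (Fin k)] {t : ℕ} {b : ℝ} (hb : b ≤ 1)
    (hbt : b ≤ learningRate k t) (L : Fin k → ℝ) (p : Fin k → C) :
    b ≤ queryProb t L p ∨
      queryProb t L p = 0 ∧ ∀ (c : C) (i j : Fin k), loss p c j = loss p c i := by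
  unfold queryProb
  split_ifs with h
  · exact Or.inl (le_min hb (hbt.trans (le_max_right _ _)))
  · refine Or.inr ⟨rfl, fun c i j => ?_⟩
    have := eq_of_maxVariance_eq_zero (weight_pos t L) (sum_weight t L) (not_not.1 h) i j
    simp [loss, this]

/-- The Taylor remainder after the quadratic term is at most `(2/9) |y|³ ≤ (4/27) y²`, which fits
between the coefficients `1/2` and `3/4`. -/
lemma exp_le_one_add_add_sq {y : ℝ} (hy : |y| ≤ 2 / 3) : Real.exp y ≤ 1 + y + 3 / 4 * y ^ 2 := by
  have h := Real.exp_bound (x := y) (hy.trans (by norm_num)) (n := 3) (by norm_num)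
  simp [Finset.sum_range_succ, Nat.factorial] at h
  have h1 := (abs_le.1 h).2
  have h2 : |y| ^ 3 ≤ 2 / 3 * y ^ 2 := by
    rw [← sq_abs y]; nlinarith [sq_nonneg |y|]
  nlinarith [sq_nonneg y]

/-- The inequality for the moment generating function of an importance-weighted loss. -/
lemma query_exp_bound {q g s B : ℝ} (hB : 0 < B) (hs : 0 ≤ s) (hsB : s * B ≤ 2 / 3) (hg : |g| ≤ 1)
    (h : B⁻¹ ≤ q ∨ q = 0 ∧ g = 0) :
    (Real.exp (-s * (1 / q * g)) - 1) * q ≤ -s * g + 3 / 4 * s ^ 2 * B * g ^ 2 := by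
  rcases h with h | ⟨rfl, rfl⟩
  · have hq : 0 < q := (inv_pos.2 hB).trans_le h
    have hq' : 1 / q ≤ B := by rw [one_div]; exact inv_le_of_inv_le₀ hB h
    have h0 : 0 ≤ 1 / q := by positivity
    have hy : |-s * (1 / q * g)| ≤ 2 / 3 := by
      rw [abs_mul, abs_mul, abs_neg, abs_of_nonneg hs, abs_of_nonneg h0]
      calc s * (1 / q * |g|) ≤ s * (B * 1) := by gcongr
        _ ≤ 2 / 3 := by linarith
    have h1 := exp_le_one_add_add_sq hy
    -- The probability `q` cancels the weight `1/q` in the linear term and one of the two in the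
    -- quadratic term, so the variance costs only one factor `B`.
    calc (Real.exp (-s * (1 / q * g)) - 1) * q
        ≤ (-s * (1 / q * g) + 3 / 4 * (-s * (1 / q * g)) ^ 2) * q := by gcongr; linarith
      _ = -s * g + 3 / 4 * s ^ 2 * (1 / q) * g ^ 2 := by field_simp
      _ ≤ -s * g + 3 / 4 * s ^ 2 * B * g ^ 2 := by gcongr
  · simp

lemma abs_one_div_mul_le {q g B : ℝ} (hB : 0 < B) (hg : |g| ≤ 1) (h : B⁻¹ ≤ q ∨ q = 0 ∧ g = 0) :
    |1 / q * g| ≤ B := by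
  rcases h with h | ⟨rfl, rfl⟩
  · have hq : 0 < q := (inv_pos.2 hB).trans_le h
    have hq' : 1 / q ≤ B := by rw [one_div]; exact inv_le_of_inv_le₀ hB h
    have h0 : 0 ≤ 1 / q := by positivity
    rw [abs_mul, abs_of_nonneg h0]
    calc 1 / q * |g| ≤ B * 1 := by gcongr
      _ = B := mul_one B
  · simpa using hB.le

end Deterministic

/-! ### Measurability -/

section Measurability

/-- Joint measurability when the second variable ranges over a countable set. -/
lemma measurable_comp₂_of_countable {Ω α β γ : Type*} {_ : MeasurableSpace Ω} [MeasurableSpace α]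
    [MeasurableSpace β] [MeasurableSpace γ] [Countable β] [MeasurableSingletonClass β]
    {F : α → β → γ} (hF : ∀ y, Measurable fun x => F x y) {u : Ω → α} {v : Ω → β}
    (hu : Measurable u) (hv : Measurable v) : Measurable fun ω => F (u ω) (v ω) := by
  have h : Measurable (Function.uncurry F) := measurable_from_prod_countable_left hF
  exact h.comp (hu.prodMk hv)

lemma measurable_weight {k : ℕ} (t : ℕ) (i : Fin k) :
    Measurable fun L : Fin k → ℝ => weight t L i := by
  unfold weight; fun_prop

variable {C : Type*} [DecidableEq C] [Fintype C] {k : ℕ}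

lemma measurable_queryProb (t : ℕ) (p : Fin k → C) :
    Measurable fun L : Fin k → ℝ => queryProb t L p := by
  have h1 : Measurable fun L : Fin k → ℝ => maxVariance p (weight t L) := by
    unfold maxVariance
    refine Measurable.iSup fun c => ?_
    have : Measurable fun L : Fin k → ℝ => ∑ i, weight t L i * loss p c i :=
      Finset.measurable_sum _ fun i _ => (measurable_weight t i).mul_const _
    exact this.mul (this.const_sub 1)
  unfold queryProb
  refine Measurable.ite ?_ (measurable_const.min (h1.max measurable_const)) measurable_const
  exact (h1 (measurableSet_singleton 0)).compl

variable [MeasurableSpace C] [MeasurableSingletonClass C]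

lemma measurable_loss {Ω : Type*} {_ : MeasurableSpace Ω} {p : Ω → Fin k → C} {c : Ω → C}
    (hp : Measurable p) (hc : Measurable c) (i : Fin k) :
    Measurable fun ω => loss (p ω) (c ω) i :=
  (measurable_of_finite fun z : (Fin k → C) × C => loss z.1 z.2 i).comp (hp.prodMk hc)

lemma measurable_queryProb_comp {Ω : Type*} {_ : MeasurableSpace Ω} (t : ℕ) {L : Ω → Fin k → ℝ}
    {p : Ω → Fin k → C} (hL : Measurable L) (hp : Measurable p) :
    Measurable fun ω => queryProb t (L ω) (p ω) :=
  measurable_comp₂_of_countable (F := fun L p => queryProb t L p) (measurable_queryProb t) hL hp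

lemma measurable_estLoss {Ω X : Type*} {_ : MeasurableSpace Ω} [MeasurableSpace X]
    {f : Fin k → X → C} (hf : ∀ i, Measurable (f i)) {x : ℕ → Ω → X} {c : ℕ → Ω → C} {Q : ℕ → Ω → Bool}
    (n : ℕ) (h : ∀ t ∈ Finset.Icc 1 n, Measurable (x t) ∧ Measurable (c t) ∧ Measurable (Q t)) :
    Measurable fun ω => estLoss f (fun s => x s ω) (fun s => c s ω) (fun s => Q s ω) n := by
  induction n with
  | zero => exact measurable_const
  | succ n ih =>
    have hL := ih fun t ht => h t (Finset.Icc_subset_Icc_right n.le_succ ht)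
    obtain ⟨hx, hc, hQ⟩ := h (n + 1) (by simp)
    have hp : Measurable fun ω j => f j (x (n + 1) ω) :=
      measurable_pi_lambda _ fun j => (hf j).comp hx
    refine measurable_pi_lambda _ fun i => ?_
    refine (measurable_pi_iff.1 hL i).add (Measurable.ite ?_ ?_ measurable_const)
    · exact hQ (measurableSet_singleton true)
    · exact ((measurable_queryProb_comp (n + 1) hL hp).const_div 1).mul (measurable_loss hp hc i)

end Measurability

/-- Averaging a coin against its conditional success probability. -/
lemma integral_mul_eq_integral_mul_of_condExp {Ω : Type*} {m m₀ : MeasurableSpace Ω} {μ : Measure Ω}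
    [IsFiniteMeasure μ] (hm : m ≤ m₀) {Y u q : Ω → ℝ} (hY : Measurable[m] Y) {b : ℝ}
    (hb : ∀ ω, |Y ω| ≤ b) (hu : Integrable u μ) (hq : μ[u | m] =ᵐ[μ] q) :
    ∫ ω, Y ω * u ω ∂μ = ∫ ω, Y ω * q ω ∂μ := by
  have h := condExp_stronglyMeasurable_mul_of_bound hm hY.stronglyMeasurable hu b (.of_forall hb)
  calc ∫ ω, Y ω * u ω ∂μ = ∫ ω, (μ[Y * u | m]) ω ∂μ := (integral_condExp hm).symm
    _ = ∫ ω, Y ω * q ω ∂μ := by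
      refine integral_congr_ae ?_
      filter_upwards [h, hq] with ω h1 h2
      rw [h1, Pi.mul_apply, h2]

/-! ### One round in abstract form -/

/-- An exponential moment is multiplied by at most `∫ (1 - s l + (3/4) s² B l²)` when an
importance-weighted copy of the loss difference `l` of a fresh example is added. -/
lemma integral_mul_exp_query_le {Ω Z : Type*} {H M m₀ : MeasurableSpace Ω} [MeasurableSpace Z]
    {μ : Measure Ω} [IsProbabilityMeasure μ] {D : Measure Z} [IsProbabilityMeasure D]
    (hH : H ≤ m₀) (hHM : H ≤ M) (hM : M ≤ m₀) {G q u : Ω → ℝ} {z : Ω → Z} {l : Z → ℝ} {b s B : ℝ}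
    (hz : Measurable[M] z) (hlaw : Measure.map z μ = D)
    (hind : Indep (MeasurableSpace.comap z inferInstance) H μ)
    (hG : Measurable[H] G) (hG0 : ∀ ω, 0 ≤ G ω) (hGb : ∀ ω, |G ω| ≤ b)
    (hq : Measurable[M] q) (hu : Measurable u) (hub : ∀ ω, |u ω| ≤ 1) (huq : μ[u | M] =ᵐ[μ] q)
    (hl : Measurable l) (hl1 : ∀ y, |l y| ≤ 1) (hs : 0 ≤ s) (hB : 0 < B) (hsB : s * B ≤ 2 / 3)
    (hcase : ∀ ω, B⁻¹ ≤ q ω ∨ q ω = 0 ∧ l (z ω) = 0) :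
    ∫ ω, G ω * (1 + (Real.exp (-s * (1 / q ω * l (z ω))) - 1) * u ω) ∂μ ≤
      (∫ ω, G ω ∂μ) * ∫ y, (1 - s * l y + 3 / 4 * s ^ 2 * B * l y ^ 2) ∂D := by
  set Y : Ω → ℝ := fun ω => G ω * (Real.exp (-s * (1 / q ω * l (z ω))) - 1) with hY
  set R : Z → ℝ := fun y => 1 - s * l y + 3 / 4 * s ^ 2 * B * l y ^ 2 with hR
  have hYM : Measurable[M] Y := (hG.mono hHM le_rfl).mul
    ((Real.measurable_exp.comp (((hq.const_div 1).mul (hl.comp hz)).const_mul (-s))).sub_const 1)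
  have hGm : Measurable G := hG.mono hH le_rfl
  have hzm : Measurable z := hz.mono hM le_rfl
  have hEb : ∀ ω, |Real.exp (-s * (1 / q ω * l (z ω))) - 1| ≤ Real.exp (s * B) + 1 := fun ω => by
    have h1 := abs_le.1 (abs_one_div_mul_le hB (hl1 (z ω)) (hcase ω))
    have h2 : Real.exp (-s * (1 / q ω * l (z ω))) ≤ Real.exp (s * B) :=
      Real.exp_le_exp.2 (by nlinarith)
    rw [abs_le]
    constructor <;> linarith [Real.exp_pos (-s * (1 / q ω * l (z ω))), Real.exp_pos (s * B)]
  have hYb : ∀ ω, |Y ω| ≤ b * (Real.exp (s * B) + 1) := fun ω => by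
    rw [hY, abs_mul]
    exact mul_le_mul (hGb ω) (hEb ω) (abs_nonneg _) ((abs_nonneg _).trans (hGb ω))
  have hui : Integrable u μ := .of_bound hu.aestronglyMeasurable 1 (.of_forall hub)
  have hGi : Integrable G μ := .of_bound hGm.aestronglyMeasurable _ (.of_forall hGb)
  have hYi : Integrable Y μ :=
    .of_bound (hYM.mono hM le_rfl).aestronglyMeasurable _ (.of_forall hYb)
  have hYu : Integrable (fun ω => Y ω * u ω) μ :=
    hYi.mul_bdd hu.aestronglyMeasurable (.of_forall hub)
  -- No upper bound on `q` is assumed; integrability comes from `Y * q` being a version of the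
  -- conditional expectation of `Y * u`.
  have hYq : Integrable (fun ω => Y ω * q ω) μ := by
    refine (integrable_condExp (μ := μ) (m := M) (f := Y * u)).congr ?_
    filter_upwards [condExp_stronglyMeasurable_mul_of_bound hM hYM.stronglyMeasurable hui _
      (.of_forall hYb), huq] with ω h1 h2
    rw [h1, Pi.mul_apply, h2]
  have hRm : Measurable R := ((hl.const_mul s).const_sub 1).add ((hl.pow_const 2).const_mul _)
  have hli : Integrable l D := .of_bound hl.aestronglyMeasurable 1 (.of_forall hl1)
  have hl2 : Integrable (fun y => l y ^ 2) D :=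
    .of_bound (hl.pow_const 2).aestronglyMeasurable 1 (.of_forall fun y => by
      rw [norm_pow]; exact pow_le_one₀ (norm_nonneg _) (hl1 y))
  have hRi : Integrable R D := ((integrable_const _).sub (hli.const_mul s)).add (hl2.const_mul _)
  have hRz : ∫ ω, R (z ω) ∂μ = ∫ y, R y ∂D := by
    rw [← hlaw]
    exact (integral_map hzm.aemeasurable hRm.aestronglyMeasurable).symm
  -- `G` depends only on the past and `R ∘ z` only on the fresh example; bounding the conditional
  -- increment by `R ∘ z`, which no longer involves `q`, is what makes the integral factor.
  have hGR : IndepFun G (fun ω => R (z ω)) μ := by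
    rw [IndepFun_iff_Indep]
    exact indep_of_indep_of_le_left (indep_of_indep_of_le_right hind.symm
      (hRm.comp (comap_measurable z)).comap_le) hG.comap_le
  have hGRi : Integrable (fun ω => G ω * R (z ω)) μ := by
    refine hGR.integrable_mul hGi ?_
    have h1 : Integrable R (Measure.map z μ) := by rw [hlaw]; exact hRi
    exact h1.comp_measurable hzm
  calc ∫ ω, G ω * (1 + (Real.exp (-s * (1 / q ω * l (z ω))) - 1) * u ω) ∂μ
      = ∫ ω, (G ω + Y ω * u ω) ∂μ := by
        refine integral_congr_ae (.of_forall fun ω => ?_)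
        simp only [hY]
        ring
    _ = ∫ ω, (G ω + Y ω * q ω) ∂μ := by
        rw [integral_add hGi hYu, integral_add hGi hYq,
          integral_mul_eq_integral_mul_of_condExp hM hYM hYb hui huq]
    _ ≤ ∫ ω, G ω * R (z ω) ∂μ := by
        refine integral_mono (hGi.add hYq) hGRi fun ω => ?_
        have h1 := mul_le_mul_of_nonneg_left (query_exp_bound hB hs hsB (hl1 (z ω)) (hcase ω))
          (hG0 ω)
        simp only [hY, hR]
        linarith
    _ = (∫ ω, G ω ∂μ) * ∫ y, R y ∂D := by
        rw [hGR.integral_fun_mul_eq_mul_integral hGm.aestronglyMeasurable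
          (hRm.comp hzm).aestronglyMeasurable, hRz]

/-! ### Executions -/

section Pathwise

variable {Ω X C : Type*} [DecidableEq C] {k : ℕ} {f : Fin k → X → C} {T : ℕ}
  {x : ℕ → Ω → X} {c : ℕ → Ω → C} {Q : ℕ → Ω → Bool}

/-- The estimated cumulative losses along an execution. -/
noncomputable def runLoss (f : Fin k → X → C) (x : ℕ → Ω → X) (c : ℕ → Ω → C) (Q : ℕ → Ω → Bool)
    (n : ℕ) (ω : Ω) : Fin k → ℝ :=
  estLoss f (fun s => x s ω) (fun s => c s ω) (fun s => Q s ω) n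

/-- The difference of the losses of the models `j` and `i` on an example. -/
noncomputable def lossDiff (f : Fin k → X → C) (i j : Fin k) (z : X × C) : ℝ :=
  loss (fun l => f l z.1) z.2 j - loss (fun l => f l z.1) z.2 i

lemma abs_lossDiff_le_one (i j : Fin k) (z : X × C) : |lossDiff f i j z| ≤ 1 :=
  abs_loss_sub_loss_le_one _ _ i j

lemma runLoss_sub_succ (n : ℕ) (ω : Ω) (i j : Fin k) :
    runLoss f x c Q (n + 1) ω j - runLoss f x c Q (n + 1) ω i =
      runLoss f x c Q n ω j - runLoss f x c Q n ω i +
        if Q (n + 1) ω = true then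
          1 / queryProb (n + 1) (runLoss f x c Q n ω) (fun l => f l (x (n + 1) ω)) *
            lossDiff f i j (x (n + 1) ω, c (n + 1) ω)
        else 0 := by
  simp only [runLoss, estLoss, lossDiff]
  split_ifs <;> ring

/-- Loss differences lie in `{-1, 0, 1}`; hence their second moment is the disagreement probability
`θ`. -/
lemma lossDiff_sq_eq_indicator (i j : Fin k) : (fun y => lossDiff f i j y ^ 2) =
    Set.indicator {y | loss (fun l => f l y.1) y.2 j ≠ loss (fun l => f l y.1) y.2 i}
      fun _ => (1 : ℝ) := by
  funext y
  simp only [Set.indicator, Set.mem_ofPred_eq, lossDiff, loss]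
  split_ifs <;> simp_all

/-- The bounds for the query probability in the form in which they are used. -/
lemma queryProb_runLoss_cases [Finite C] {B : ℝ} (hB1 : 1 ≤ B)
    (hBT : ∀ t ∈ Finset.Icc 1 T, B⁻¹ ≤ learningRate k t)
    {n : ℕ} (hn : n + 1 ≤ T) (i j : Fin k) (L : Fin k → ℝ) (z : X × C) :
    B⁻¹ ≤ queryProb (n + 1) L (fun l => f l z.1) ∨
      queryProb (n + 1) L (fun l => f l z.1) = 0 ∧ lossDiff f i j z = 0 := by
  have : Nonempty (Fin k) := ⟨i⟩
  refine (queryProb_cases (inv_le_one_of_one_le₀ hB1) (hBT (n + 1) (by simp; omega)) L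
    (fun l => f l z.1)).imp_right fun h => ⟨h.1, ?_⟩
  simp [lossDiff, h.2 z.2 i j]

/-- A crude pathwise bound, one `B` per round, needed only to keep the exponentials bounded and thus
integrable. -/
lemma abs_runLoss_sub_le [Finite C] {B : ℝ} (hB1 : 1 ≤ B)
    (hBT : ∀ t ∈ Finset.Icc 1 T, B⁻¹ ≤ learningRate k t)
    {n : ℕ} (hn : n ≤ T) (i j : Fin k) (ω : Ω) :
    |runLoss f x c Q n ω j - runLoss f x c Q n ω i| ≤ n * B := by
  induction n with
  | zero => simp [runLoss, estLoss]
  | succ n ih =>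
    rw [runLoss_sub_succ]
    refine (abs_add_le _ _).trans ?_
    have h1 := ih (by omega)
    push_cast
    rw [add_mul, one_mul]
    refine add_le_add h1 ?_
    split_ifs
    · exact abs_one_div_mul_le (by linarith) (abs_lossDiff_le_one i j _)
        (queryProb_runLoss_cases hB1 hBT hn i j _ (x (n + 1) ω, c (n + 1) ω))
    · simp; linarith

lemma abs_exp_runLoss_le [Finite C] {s B : ℝ} (hs : 0 ≤ s) (hB1 : 1 ≤ B)
    (hBT : ∀ t ∈ Finset.Icc 1 T, B⁻¹ ≤ learningRate k t) {n : ℕ} (hn : n ≤ T) (i j : Fin k)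
    (ω : Ω) :
    |Real.exp (-s * (runLoss f x c Q n ω j - runLoss f x c Q n ω i))| ≤ Real.exp (s * (n * B)) := by
  rw [abs_of_pos (Real.exp_pos _)]
  refine Real.exp_le_exp.2 ?_
  have h1 := abs_le.1 (abs_runLoss_sub_le (f := f) (x := x) (c := c) (Q := Q) hB1 hBT hn i j ω)
  nlinarith

end Pathwise

section Run

variable {Ω X C : Type*} [MeasurableSpace X] [MeasurableSpace C] {k : ℕ}
  {x : ℕ → Ω → X} {c : ℕ → Ω → C} {I : ℕ → Ω → Fin k} {Q : ℕ → Ω → Bool}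

/-- Everything that was observed before round `t` is measurable for the history. -/
lemma measurable_history {s t : ℕ} (hs : s ∈ Finset.Ico 1 t) :
    Measurable[history x c I Q t] fun ω => (x s ω, c s ω, I s ω, Q s ω) :=
  Measurable.of_comap_le (le_iSup₂_of_le (f := fun s _ =>
    MeasurableSpace.comap (fun ω => (x s ω, c s ω, I s ω, Q s ω)) inferInstance) s hs le_rfl)

/-- Losses after round `n` involve rounds `1, …, n`, which is exactly the history before round `n +
1`. -/
lemma measurable_runLoss_history [DecidableEq C] [Fintype C] [MeasurableSingletonClass C]
    {f : Fin k → X → C} (hf : ∀ i, Measurable (f i)) (n : ℕ) :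
    Measurable[history x c I Q (n + 1)] (runLoss f x c Q n) := by
  refine measurable_estLoss hf n fun t ht => ?_
  have h := measurable_history (x := x) (c := c) (I := I) (Q := Q) (s := t) (t := n + 1)
    (by simp at ht ⊢; omega)
  exact ⟨measurable_fst.comp h, measurable_fst.comp (measurable_snd.comp h),
    measurable_snd.comp (measurable_snd.comp (measurable_snd.comp h))⟩

variable [MeasurableSpace Ω] [DecidableEq C] {D : Measure (X × C)} {f : Fin k → X → C}
  {μ : Measure Ω} {T : ℕ}

lemma IsRun.history_le (h : IsRun D f μ T x c I Q) {t : ℕ} (ht : t ≤ T + 1) :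
    history x c I Q t ≤ ‹MeasurableSpace Ω› := by
  refine iSup₂_le fun s hs => ?_
  have hs' : s ∈ Finset.Icc 1 T := by simp at hs ⊢; omega
  exact ((h.measurable_x s hs').prodMk ((h.measurable_c s hs').prodMk
    ((h.measurable_I s hs').prodMk (h.measurable_Q s hs')))).comap_le

lemma accGap_self (i : Fin k) : accGap D f i i = 0 := by simp [accGap]

lemma disagreement_le_one [IsProbabilityMeasure D] (i j : Fin k) : disagreement D f i j ≤ 1 :=
  measureReal_le_one

variable [Fintype C] [MeasurableSingletonClass C]

lemma measurable_lossDiff (hf : ∀ i, Measurable (f i)) (i j : Fin k) :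
    Measurable (lossDiff f i j) := by
  have hp : Measurable fun (z : X × C) l => f l z.1 :=
    measurable_pi_lambda _ fun l => (hf l).comp measurable_fst
  exact (measurable_loss hp measurable_snd j).sub (measurable_loss hp measurable_snd i)

lemma integral_lossDiff_sq (hf : ∀ i, Measurable (f i)) (i j : Fin k) :
    ∫ y, lossDiff f i j y ^ 2 ∂D = disagreement D f i j := by
  have hset : MeasurableSet
      {y : X × C | loss (fun l => f l y.1) y.2 j ≠ loss (fun l => f l y.1) y.2 i} := by
    have h1 : {y : X × C | loss (fun l => f l y.1) y.2 j ≠ loss (fun l => f l y.1) y.2 i} =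
        {y | lossDiff f i j y ≠ 0} := by
      ext y; simp [lossDiff, sub_eq_zero]
    rw [h1]
    exact (measurable_lossDiff hf i j (measurableSet_singleton 0)).compl
  rw [lossDiff_sq_eq_indicator, integral_indicator hset]
  simp [disagreement]

variable [IsProbabilityMeasure D]

lemma integrable_lossDiff (hf : ∀ i, Measurable (f i)) (i j : Fin k) :
    Integrable (lossDiff f i j) D :=
  .of_bound (measurable_lossDiff hf i j).aestronglyMeasurable 1
    (.of_forall (abs_lossDiff_le_one i j))

lemma integrable_lossDiff_sq (hf : ∀ i, Measurable (f i)) (i j : Fin k) :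
    Integrable (fun y => lossDiff f i j y ^ 2) D :=
  .of_bound ((measurable_lossDiff hf i j).pow_const 2).aestronglyMeasurable 1
    (.of_forall fun y => by
      rw [norm_pow]; exact pow_le_one₀ (norm_nonneg _) (abs_lossDiff_le_one i j y))

/-- Since the loss difference `d` lies in `{-1, 0, 1}`, `d ≤ d²`. The resulting `Δ ≤ θ` keeps the
Chernoff parameter admissible and the hardness at most `1`. -/
lemma accGap_le_disagreement (hf : ∀ i, Measurable (f i)) (i j : Fin k) :
    accGap D f i j ≤ disagreement D f i j := by
  rw [← integral_lossDiff_sq hf]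
  refine integral_mono (integrable_lossDiff hf i j) (integrable_lossDiff_sq hf i j) fun y => ?_
  simp only [lossDiff, loss]
  split_ifs <;> norm_num

/-! ### The exponential moments of the estimated losses -/

variable [IsProbabilityMeasure μ]

/-- One round multiplies the exponential moment by at most `1 - s Δ + (3/4) s² B θ`. -/
lemma integral_exp_succ_le (hf : ∀ i, Measurable (f i)) (h : IsRun D f μ T x c I Q) {s B : ℝ}
    (hs : 0 ≤ s) (hB1 : 1 ≤ B) (hsB : s * B ≤ 2 / 3)
    (hBT : ∀ t ∈ Finset.Icc 1 T, B⁻¹ ≤ learningRate k t) {n : ℕ} (hn : n + 1 ≤ T) (i j : Fin k) :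
    ∫ ω, Real.exp (-s * (runLoss f x c Q (n + 1) ω j - runLoss f x c Q (n + 1) ω i)) ∂μ ≤
      (∫ ω, Real.exp (-s * (runLoss f x c Q n ω j - runLoss f x c Q n ω i)) ∂μ) *
        (1 - s * accGap D f i j + 3 / 4 * s ^ 2 * B * disagreement D f i j) := by
  have ht : n + 1 ∈ Finset.Icc 1 T := by simp; omega
  have hHle := h.history_le (t := n + 1) (by omega)
  have hxyz := (h.measurable_x _ ht).prodMk ((h.measurable_c _ ht).prodMk (h.measurable_I _ ht))
  have hMle := sup_le hHle hxyz.comap_le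
  have hHM : history x c I Q (n + 1) ≤ history x c I Q (n + 1) ⊔
      MeasurableSpace.comap (fun ω => (x (n + 1) ω, c (n + 1) ω, I (n + 1) ω)) inferInstance :=
    le_sup_left
  have hLH := measurable_runLoss_history (x := x) (c := c) (I := I) (Q := Q) hf n
  have hGH : Measurable[history x c I Q (n + 1)] fun ω =>
      Real.exp (-s * (runLoss f x c Q n ω j - runLoss f x c Q n ω i)) := by
    have h1 : Measurable fun L : Fin k → ℝ => Real.exp (-s * (L j - L i)) := by fun_prop
    exact h1.comp hLH
  have htriple : Measurable[history x c I Q (n + 1) ⊔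
      MeasurableSpace.comap (fun ω => (x (n + 1) ω, c (n + 1) ω, I (n + 1) ω)) inferInstance]
      fun ω => (x (n + 1) ω, c (n + 1) ω, I (n + 1) ω) := Measurable.of_comap_le le_sup_right
  have hpair : Measurable fun y : X × C × Fin k => (y.1, y.2.1) := by fun_prop
  have hzM := hpair.comp htriple
  have hf' : Measurable fun (y : X × C) l => f l y.1 :=
    measurable_pi_lambda _ fun l => (hf l).comp measurable_fst
  have hqM := measurable_queryProb_comp (n + 1) (hLH.mono hHM le_rfl) (hf'.comp hzM)
  have hum : Measurable fun ω => if Q (n + 1) ω = true then (1 : ℝ) else 0 :=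
    Measurable.ite (h.measurable_Q _ ht (measurableSet_singleton true)) measurable_const
      measurable_const
  have key := integral_mul_exp_query_le (l := lossDiff f i j) hHle hHM hMle hzM
    (h.law_stream _ ht) (h.indep_stream _ ht) hGH (fun ω => (Real.exp_pos _).le)
    (abs_exp_runLoss_le hs hB1 hBT (by omega) i j) hqM hum
    (fun ω => by split_ifs <;> simp) (h.condProb_Q _ ht) (measurable_lossDiff hf i j)
    (abs_lossDiff_le_one i j) hs (by linarith) hsB
    (fun ω => queryProb_runLoss_cases hB1 hBT hn i j _ (x (n + 1) ω, c (n + 1) ω))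
  have hR : ∫ y, (1 - s * lossDiff f i j y + 3 / 4 * s ^ 2 * B * lossDiff f i j y ^ 2) ∂D =
      1 - s * accGap D f i j + 3 / 4 * s ^ 2 * B * disagreement D f i j := by
    have hli := (integrable_lossDiff (D := D) hf i j).const_mul s
    have hsub : Integrable (fun y => 1 - s * lossDiff f i j y) D := (integrable_const _).sub hli
    rw [integral_add hsub ((integrable_lossDiff_sq hf i j).const_mul _),
      integral_sub (integrable_const _) hli, integral_const_mul, integral_const_mul,
      integral_lossDiff_sq hf]
    simp [accGap, lossDiff]
  rw [hR] at key
  -- The exponential of the increment is `1 + (exp (…) - 1) 𝟙{Q = 1}`: without a query the factor is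
  -- `1`.
  refine le_of_eq_of_le (integral_congr_ae (.of_forall fun ω => ?_)) key
  simp only [runLoss_sub_succ, mul_add, Real.exp_add, Function.comp_apply]
  split_ifs
  · ring
  · simp

end Run

/-! ### The recommendation -/

lemma exists_ne_of_two_le {k : ℕ} (hk : 2 ≤ k) (i : Fin k) : ∃ j, j ≠ i :=
  have : Nontrivial (Fin k) := Fin.nontrivial_iff_two_le.2 hk
  exists_ne i

lemma integral_comp_eq_sum {Ω : Type*} [MeasurableSpace Ω] {μ : Measure Ω}
    [IsFiniteMeasure μ] {k : ℕ} {r : Ω → Fin k} (hr : Measurable r) (a : Fin k → ℝ) :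
    ∫ ω, a (r ω) ∂μ = ∑ j, a j * μ.real (r ⁻¹' {j}) := by
  have h1 : (fun ω => a (r ω)) = fun ω => ∑ j, (r ⁻¹' {j}).indicator (fun _ => a j) ω := by
    funext ω
    rw [Finset.sum_eq_single (r ω)] <;> simp +contextual [Set.indicator, eq_comm]
  have hset : ∀ j, MeasurableSet (r ⁻¹' {j}) := fun j => hr (measurableSet_singleton j)
  rw [h1, integral_finsetSum _ fun j _ => (integrable_const (a j)).indicator (hset j)]
  refine Finset.sum_congr rfl fun j _ => ?_
  rw [integral_indicator (hset j)]
  simp [mul_comm]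

section Recommendation

variable {Ω X C : Type*} [MeasurableSpace Ω] [MeasurableSpace X] [DecidableEq C]
  [MeasurableSpace C] {k : ℕ} {D : Measure (X × C)} {f : Fin k → X → C}
  {μ : Measure Ω} [IsProbabilityMeasure μ] {T : ℕ}
  {x : ℕ → Ω → X} {c : ℕ → Ω → C} {I : ℕ → Ω → Fin k} {Q : ℕ → Ω → Bool} {r : Ω → Fin k}

lemma accGap_le_maxGap (i j : Fin k) : accGap D f i j ≤ maxGap D f i :=
  le_ciSup (f := fun j => accGap D f i j) (Set.finite_range _).bddAbove j

lemma integral_accGap_le_maxGap (i : Fin k) (hr : Measurable r) :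
    ∫ ω, accGap D f i (r ω) ∂μ ≤ maxGap D f i := by
  have h : Integrable (fun ω => accGap D f i (r ω)) μ :=
    Integrable.comp_measurable (f := r) (g := fun j => accGap D f i j) (.of_finite) hr
  refine (integral_mono h (integrable_const (maxGap D f i)) fun ω => accGap_le_maxGap i _).trans ?_
  simp

variable [Fintype C] [MeasurableSingletonClass C]

lemma integrable_exp_runLoss (hf : ∀ i, Measurable (f i)) (h : IsRun D f μ T x c I Q) {s B : ℝ}
    (hs : 0 ≤ s) (hB1 : 1 ≤ B) (hBT : ∀ t ∈ Finset.Icc 1 T, B⁻¹ ≤ learningRate k t) {n : ℕ}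
    (hn : n ≤ T) (i j : Fin k) :
    Integrable (fun ω => Real.exp (-s * (runLoss f x c Q n ω j - runLoss f x c Q n ω i))) μ := by
  have hL : Measurable (runLoss f x c Q n) :=
    (measurable_runLoss_history (I := I) hf n).mono (h.history_le (by omega)) le_rfl
  have h1 : Measurable fun L : Fin k → ℝ => Real.exp (-s * (L j - L i)) := by fun_prop
  exact .of_bound (h1.comp hL).aestronglyMeasurable _
    (.of_forall (abs_exp_runLoss_le hs hB1 hBT hn i j))

variable [IsProbabilityMeasure D]

/-- Iterates the one-round bound, with `1 - a ≤ exp (-a)` turning the product into an exponential.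
-/
lemma integral_exp_runLoss_le (hf : ∀ i, Measurable (f i)) (h : IsRun D f μ T x c I Q) {s B : ℝ}
    (hs : 0 ≤ s) (hB1 : 1 ≤ B) (hsB : s * B ≤ 2 / 3)
    (hBT : ∀ t ∈ Finset.Icc 1 T, B⁻¹ ≤ learningRate k t) {n : ℕ} (hn : n ≤ T) (i j : Fin k) :
    ∫ ω, Real.exp (-s * (runLoss f x c Q n ω j - runLoss f x c Q n ω i)) ∂μ ≤
      Real.exp (-(n * (s * accGap D f i j - 3 / 4 * s ^ 2 * B * disagreement D f i j))) := by
  induction n with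
  | zero => simp [runLoss, estLoss]
  | succ n ih =>
    refine (integral_exp_succ_le hf h hs hB1 hsB hBT hn i j).trans ?_
    set a := s * accGap D f i j - 3 / 4 * s ^ 2 * B * disagreement D f i j with ha
    have h1 : 1 - s * accGap D f i j + 3 / 4 * s ^ 2 * B * disagreement D f i j ≤
        Real.exp (-a) := by
      linarith [Real.add_one_le_exp (-a)]
    calc _ ≤ (∫ ω, Real.exp (-s * (runLoss f x c Q n ω j - runLoss f x c Q n ω i)) ∂μ) *
          Real.exp (-a) :=
          mul_le_mul_of_nonneg_left h1 (integral_nonneg fun ω => (Real.exp_pos _).le)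
      _ ≤ Real.exp (-(n * a)) * Real.exp (-a) :=
          mul_le_mul_of_nonneg_right (ih (by omega)) (Real.exp_pos _).le
      _ = Real.exp (-((n + 1 : ℕ) * a)) := by
          rw [← Real.exp_add]; push_cast; ring_nf

/-- The probability of recommending a model of positive accuracy gap decays exponentially. -/
lemma measureReal_recommendation_le (hk : 2 ≤ k) (hf : ∀ i, Measurable (f i)) (hT : 1 ≤ T)
    (h : IsRun D f μ T x c I Q) (hr : IsRecommendation f μ x c Q T r) (hη : learningRate k T ≤ 1)
    {i j : Fin k} (hj : 0 < accGap D f i j) :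
    μ.real (r ⁻¹' {j}) ≤ Real.exp (-((T - 1) * learningRate k T *
      (accGap D f i j ^ 2 / disagreement D f i j) / 3)) := by
  set η := learningRate k T with hηdef
  set Δ := accGap D f i j with hΔ
  set θ := disagreement D f i j with hθ
  have hη0 : 0 < η := learningRate_pos hk hT
  have hle : Δ ≤ θ := accGap_le_disagreement hf i j
  have hθ0 : 0 < θ := hj.trans_le hle
  have hB1 : 1 ≤ η⁻¹ := (one_le_inv₀ hη0).2 hη
  have hBT : ∀ t ∈ Finset.Icc 1 T, η⁻¹⁻¹ ≤ learningRate k t := fun t ht => by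
    rw [inv_inv]
    obtain ⟨h1, h2⟩ := Finset.mem_Icc.1 ht
    have h1' : (0 : ℝ) < t := by exact_mod_cast h1
    have h2' : (t : ℝ) ≤ T := by exact_mod_cast h2
    have := (log_natCast_pos hk).le
    exact Real.sqrt_le_sqrt (by gcongr)
  -- This `s` maximizes `s Δ - (3/4) s² θ / η`, with maximum `η Δ² / (3 θ)`; `Δ ≤ θ` gives `s / η ≤
  -- 2/3`.
  set s := 2 * Δ * η / (3 * θ) with hs
  have hs0 : 0 ≤ s := by positivity
  have hsB : s * η⁻¹ ≤ 2 / 3 := by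
    have h1 : s * η⁻¹ = 2 / 3 * (Δ / θ) := by rw [hs]; field_simp
    have h2 : Δ / θ ≤ 1 := (div_le_one hθ0).2 hle
    rw [h1]; linarith
  -- The recommendation of round `T` uses the losses after only `T - 1` rounds.
  have hn : T - 1 ≤ T := by omega
  have key := integral_exp_runLoss_le hf h hs0 hB1 hsB hBT hn i j
  have hexp : ((T - 1 : ℕ) : ℝ) * (s * Δ - 3 / 4 * s ^ 2 * η⁻¹ * θ) =
      (T - 1) * η * (Δ ^ 2 / θ) / 3 := by
    rw [Nat.cast_sub hT, hs]; field_simp; push_cast; ring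
  rw [← hΔ, ← hθ, hexp] at key
  refine le_trans ?_ key
  have hset : MeasurableSet (r ⁻¹' {j}) := hr.1 (measurableSet_singleton j)
  rw [← integral_indicator_one hset]
  -- Markov's inequality: the indicator of `r = j` is dominated by the exponential, which is at
  -- least `1` when `j` does not lose to `i`.
  refine integral_mono_ae ((integrable_const 1).indicator hset)
    (integrable_exp_runLoss hf h hs0 hB1 hBT hn i j) ?_
  filter_upwards [hr.2] with ω hω
  by_cases hrj : r ω = j
  · have h1 : runLoss f x c Q (T - 1) ω j ≤ runLoss f x c Q (T - 1) ω i := by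
      rw [← hrj]; exact le_of_weight_le hk hT (hω i)
    rw [Set.indicator_of_mem (by simpa using hrj), Pi.one_apply]
    exact Real.one_le_exp (by nlinarith)
  · rw [Set.indicator_of_notMem (by simpa using hrj)]
    exact (Real.exp_pos _).le

end Recommendation

/-- The number of rounds suffices for the exponent. -/
lemma le_exponent_of_le {a l L T : ℝ} (ha : 2 / 3 ≤ a) (hl : 0 < l) (hl1 : l ≤ 1) (hL : a ≤ L)
    (hT : 31 * L ^ 2 / (l ^ 2 * a) ≤ T) :
    a ≤ 2 * T ∧ L ≤ (T - 1) * Real.sqrt (a / (2 * T)) * l / 3 := by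
  have ha0 : 0 < a := by linarith
  have h1 : 31 * L ^ 2 ≤ T * (l ^ 2 * a) := (div_le_iff₀ (by positivity)).1 hT
  have hT0 : 0 < T := by
    have : 0 < L := by linarith
    exact lt_of_lt_of_le (by positivity) hT
  -- With `a ≥ 2/3` this gives `T > 20`, so replacing `T` by `T - 1` costs little.
  have h2 : 31 * a ≤ T := by
    have h3 : T * (l ^ 2 * a) ≤ T * (1 * a) := by
      gcongr; exact pow_le_one₀ hl.le hl1
    have h4 : a * (31 * a) ≤ a * T := by nlinarith
    exact le_of_mul_le_mul_left h4 ha0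
  refine ⟨by linarith, ?_⟩
  have hT1 : 0 ≤ T - 1 := by linarith
  refine le_of_sq_le_sq ?_ (by positivity)
  have h5 : ((T - 1) * Real.sqrt (a / (2 * T)) * l / 3) ^ 2 =
      (T - 1) ^ 2 / T * (a * l ^ 2) / 18 := by
    rw [div_pow, mul_pow, mul_pow, Real.sq_sqrt (by positivity)]
    field_simp; ring
  -- The `18` is `2 · 3²`, from the `2` in the learning rate and the squared `3` in the exponent;
  -- the gap between `18` and `31` absorbs the loss from `T - 1`.
  have h6 : 18 / 31 * T ≤ (T - 1) ^ 2 / T := by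
    rw [le_div_iff₀ hT0]; nlinarith
  rw [h5]
  have h7 : 18 / 31 * T * (a * l ^ 2) ≤ (T - 1) ^ 2 / T * (a * l ^ 2) := by gcongr
  linarith

/-! ### Hardness bounds and the expected accuracy gap -/

section Main

variable {Ω X C : Type*} [MeasurableSpace Ω] [MeasurableSpace X] [DecidableEq C]
  [MeasurableSpace C] {k : ℕ} {D : Measure (X × C)} {f : Fin k → X → C}
  {μ : Measure Ω} [IsProbabilityMeasure μ] {T : ℕ}
  {x : ℕ → Ω → X} {c : ℕ → Ω → C} {I : ℕ → Ω → Fin k} {Q : ℕ → Ω → Bool} {r : Ω → Fin k}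
  {i : Fin k}

lemma hardness_le (j : Fin k) (hj : j ≠ i) :
    hardness D f i ≤ accGap D f i j ^ 2 / disagreement D f i j :=
  ciInf_le (f := fun j : {j : Fin k // j ≠ i} => accGap D f i j ^ 2 / disagreement D f i j)
    (Finite.bddBelow_range _) ⟨j, hj⟩

variable [Fintype C] [MeasurableSingletonClass C] [IsProbabilityMeasure D]

lemma hardness_pos (hk : 2 ≤ k) (hf : ∀ i, Measurable (f i))
    (hbest : ∀ j, j ≠ i → 0 < accGap D f i j) : 0 < hardness D f i := by
  obtain ⟨j, hj⟩ := exists_ne_of_two_le hk i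
  have : Nonempty {j : Fin k // j ≠ i} := ⟨⟨j, hj⟩⟩
  obtain ⟨l, hl⟩ := exists_eq_ciInf_of_finite
    (f := fun j : {j : Fin k // j ≠ i} => accGap D f i j ^ 2 / disagreement D f i j)
  rw [hardness, ← hl]
  have h1 := hbest l l.2
  exact div_pos (by positivity) (h1.trans_le (accGap_le_disagreement hf i l))

/-- From `Δ ≤ θ ≤ 1` one gets `Δ² ≤ θ`. This lets the condition on `T` imply `T ≥ 31 log k`, and so
`η_T ≤ 1`. -/
lemma hardness_le_one (hk : 2 ≤ k) (hf : ∀ i, Measurable (f i))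
    (hbest : ∀ j, j ≠ i → 0 < accGap D f i j) : hardness D f i ≤ 1 := by
  obtain ⟨j, hj⟩ := exists_ne_of_two_le hk i
  have h1 := hbest j hj
  have h2 : accGap D f i j ≤ disagreement D f i j := accGap_le_disagreement hf i j
  have h3 : disagreement D f i j ≤ 1 := disagreement_le_one i j
  refine (hardness_le j hj).trans ((div_le_one (h1.trans_le h2)).2 ?_)
  nlinarith

lemma maxGap_le_one (hf : ∀ i, Measurable (f i)) : maxGap D f i ≤ 1 := by
  have : Nonempty (Fin k) := ⟨i⟩
  exact ciSup_le fun j => (accGap_le_disagreement hf i j).trans (disagreement_le_one i j)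

/-- The expected accuracy gap after sufficiently many rounds. -/
lemma integral_accGap_le (hk : 2 ≤ k) (hf : ∀ i, Measurable (f i))
    (hbest : ∀ j, j ≠ i → 0 < accGap D f i j) (hT : 1 ≤ T) (h : IsRun D f μ T x c I Q)
    (hr : IsRecommendation f μ x c Q T r) {ε : ℝ} (hε : 0 < ε) (hεM : ε < maxGap D f i)
    (hTL : 31 * Real.log (k * maxGap D f i / ε) ^ 2 / (hardness D f i ^ 2 * Real.log k) ≤ T) :
    ∫ ω, accGap D f i (r ω) ∂μ ≤ ε := by
  set M := maxGap D f i with hM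
  have hM0 : 0 < M := hε.trans hεM
  have hk0 : (0 : ℝ) < k := by positivity
  have ha : 2 / 3 ≤ Real.log k := by
    have h1 : Real.log 2 ≤ Real.log k := Real.log_le_log (by norm_num) (by exact_mod_cast hk)
    linarith [Real.log_two_gt_d9]
  -- This is where `ε < M` enters.
  have hL : Real.log k ≤ Real.log (k * M / ε) := by
    refine Real.log_le_log hk0 ?_
    rw [le_div_iff₀ hε]
    gcongr
  obtain ⟨h1, h2⟩ := le_exponent_of_le ha (hardness_pos hk hf hbest)
    (hardness_le_one hk hf hbest) hL hTL
  have hT' : (1 : ℝ) ≤ T := by exact_mod_cast hT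
  have hη : learningRate k T ≤ 1 := by
    rw [learningRate, Real.sqrt_le_iff]
    exact ⟨zero_le_one, by rw [one_pow]; exact (div_le_one (by positivity)).2 h1⟩
  rw [integral_comp_eq_sum hr.1]
  have hterm : ∀ j, accGap D f i j * μ.real (r ⁻¹' {j}) ≤ ε / k := fun j => by
    rcases eq_or_ne j i with rfl | hj
    · rw [accGap_self, zero_mul]; positivity
    · have h3 := measureReal_recommendation_le hk hf hT h hr hη (hbest j hj)
      have h4 : Real.log (k * M / ε) ≤ (T - 1) * learningRate k T *
          (accGap D f i j ^ 2 / disagreement D f i j) / 3 := by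
        refine h2.trans ?_
        have h5 : 0 ≤ (T - 1) * learningRate k T :=
          mul_nonneg (by linarith) (Real.sqrt_nonneg _)
        exact div_le_div_of_nonneg_right
          (mul_le_mul_of_nonneg_left (hardness_le j hj) h5) (by norm_num)
      have h6 : μ.real (r ⁻¹' {j}) ≤ (k * M / ε)⁻¹ := by
        refine h3.trans ?_
        rw [← Real.exp_log (show 0 < k * M / ε by positivity), ← Real.exp_neg]
        exact Real.exp_le_exp.2 (by linarith)
      calc accGap D f i j * μ.real (r ⁻¹' {j}) ≤ M * (k * M / ε)⁻¹ :=
            mul_le_mul (accGap_le_maxGap i j) h6 measureReal_nonneg hM0.le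
        _ = ε / k := by field_simp
  calc ∑ j, accGap D f i j * μ.real (r ⁻¹' {j}) ≤ ∑ _j : Fin k, ε / k :=
        Finset.sum_le_sum fun j _ => hterm j
    _ = ε := by simp; field_simp

end Main

end ModelPicker

theorem mainTheorem7 {Ω X C : Type*} [MeasurableSpace Ω] [MeasurableSpace X]
    [Fintype C] [DecidableEq C] [MeasurableSpace C] [MeasurableSingletonClass C]
    (D : Measure (X × C)) [IsProbabilityMeasure D]
    (k : ℕ) (hk : 2 ≤ k) (f : Fin k → X → C) (hf : ∀ i, Measurable (f i))
    (iStar : Fin k) (hbest : ∀ j, j ≠ iStar → 0 < ModelPicker.accGap D f iStar j)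
    (μ : Measure Ω) [IsProbabilityMeasure μ] (T : ℕ) (hT : 1 ≤ T)
    (x : ℕ → Ω → X) (c : ℕ → Ω → C) (I : ℕ → Ω → Fin k) (Q : ℕ → Ω → Bool)
    (hrun : ModelPicker.IsRun D f μ T x c I Q)
    (r : Ω → Fin k) (hr : ModelPicker.IsRecommendation f μ x c Q T r)
    (ε : ℝ) (hε : 0 < ε) :
    (31 * Real.log (k * ModelPicker.maxGap D f iStar / ε) ^ 2 /
          (ModelPicker.hardness D f iStar ^ 2 * Real.log k) ≤ (T : ℝ) →
        ∫ ω, ModelPicker.accGap D f iStar (r ω) ∂μ ≤ ε) ∧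
    (|Real.log (k * ModelPicker.maxGap D f iStar)| + Real.log (1 / ε) ≤
          |Real.log (k * ModelPicker.maxGap D f iStar)| * Real.log (1 / ε) →
      31 * (Real.log (k * ModelPicker.maxGap D f iStar) ^ 2 /
          (ModelPicker.hardness D f iStar ^ 2 * Real.log k)) * Real.log (1 / ε) ^ 2 ≤ (T : ℝ) →
        ∫ ω, ModelPicker.accGap D f iStar (r ω) ∂μ ≤ ε) := by
  -- For `ε ≥ max Δ` the logarithm may be small or negative and its square says nothing useful, but
  -- the bound is trivial.
  rcases le_or_gt (ModelPicker.maxGap D f iStar) ε with hM | hM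
  · have h := (ModelPicker.integral_accGap_le_maxGap (D := D) (f := f) (μ := μ) iStar hr.1).trans hM
    exact ⟨fun _ => h, fun _ _ => h⟩
  refine ⟨ModelPicker.integral_accGap_le hk hf hbest hT hrun hr hε hM, fun hlog hTL => ?_⟩
  refine ModelPicker.integral_accGap_le hk hf hbest hT hrun hr hε hM (le_trans ?_ hTL)
  have hM0 := hε.trans hM
  have hk0 : (0 : ℝ) < k := by positivity
  -- Here `ε < max Δ ≤ 1`. With this sign, the hypothesis that a sum is at most a product bounds
  -- `|log (k max Δ / ε)|` by the triangle inequality.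
  have hb : 0 ≤ Real.log (1 / ε) := by
    refine Real.log_nonneg ?_
    rw [le_div_iff₀ hε, one_mul]
    exact hM.le.trans (ModelPicker.maxGap_le_one (D := D) hf)
  have hsplit : Real.log (k * ModelPicker.maxGap D f iStar / ε) =
      Real.log (k * ModelPicker.maxGap D f iStar) + Real.log (1 / ε) := by
    rw [← Real.log_mul (by positivity) (by positivity), mul_one_div]
  have habs : |Real.log (k * ModelPicker.maxGap D f iStar / ε)| ≤
      |Real.log (k * ModelPicker.maxGap D f iStar) * Real.log (1 / ε)| := by
    rw [hsplit, abs_mul, abs_of_nonneg hb]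
    refine (abs_add_le _ _).trans ?_
    rwa [abs_of_nonneg hb]
  have hsq := sq_le_sq.2 habs
  have hlogk := ModelPicker.log_natCast_pos hk
  calc 31 * Real.log (k * ModelPicker.maxGap D f iStar / ε) ^ 2 /
        (ModelPicker.hardness D f iStar ^ 2 * Real.log k)
      ≤ 31 * (Real.log (k * ModelPicker.maxGap D f iStar) * Real.log (1 / ε)) ^ 2 /
        (ModelPicker.hardness D f iStar ^ 2 * Real.log k) := by gcongr
    _ = _ := by ring
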